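/- Let $n\ge 2$ be an integer and $p>1$. Let $H:\mathbb R^n\to\mathbb R$ be continuous, of class $C^2$ on $\mathbb R^n\setminus\{0\}$, positively homogeneous of degree one, positive on the unit sphere, and such that the unit ball $\{\xi: H(\xi)<1\}$ is uniformly convex, i.e. the principal curvatures of its boundary $\{H=1\}$ are bounded below by a positive constant. Put $a(\xi)=\frac1p\nabla_\xi H^p(\xi)$ and $\Delta_p^H u=\operatorname{div}(a(\nabla u))$, and, if $p<n$, $p_*=\frac{(n-1)p}{n-p}$. For a function $f:(0,\infty)\to\mathbb R$, a positive subsolution of $-\Delta_p^H u=f(u)$ in $\mathbb R^n$ is a function $u\in W^{1,p}_{\mathrm{loc}}(\mathbb R^n)\cap C(\mathbb R^n)$ with $u>0$ everywhere and $$\int_{\mathbb R^n} a(\nabla u)\cdot\nabla\varphi\,dx\le\int_{\mathbb R^n} f(u)\,\varphi\,dx\qquad\text{for all }\varphi\in C_c^\infty(\mathbb R^n),\ \varphi\ge 0.$$ Theorem 1.2. Let $f:(0,\infty)\to(-\infty,0)$ be continuous, and suppose that one of the following conditions holds: (1) $p<n$ and there is $q$ with $p-1<q<p_*-1$ such that $\int_1^\infty(-f(v))^{-1/q}\,dv<\infty$;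 (2) $p\ge n$ and there is $q>p-1$ such that $\int_1^\infty(-f(v))^{-1/q}\,dv<\infty$. Then $-\Delta_p^H u=f(u)$ has no positive subsolution in $\mathbb R^n$. In particular, for every $\alpha>p-1$, the equation $-\Delta_p^H u=-u^\alpha$ has no positive subsolution in $\mathbb R^n$. -/

import Mathlib

open MeasureTheory Set
open scoped ContDiff

noncomputable section

/-- `H` is an anisotropy on `ℝⁿ`: continuous, twice continuously differentiable away from the
origin, positively homogeneous of degree one, positive on the unit sphere, and such that its unit
ball `{H < 1}` is uniformly convex, i.e. the principal curvatures of `{H = 1}` (the eigenvalues of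
`D²H / |∇H|` on the tangent space `∇H^⊥`) are bounded below by a positive constant. -/
structure IsAnisotropy {n : ℕ} (H : EuclideanSpace ℝ (Fin n) → ℝ) : Prop where
  continuous : Continuous H
  contDiffOn : ContDiffOn ℝ 2 H {0}ᶜ
  homogeneous : ∀ t : ℝ, 0 < t → ∀ ξ, H (t • ξ) = t * H ξ
  pos_on_sphere : ∀ ξ, ‖ξ‖ = 1 → 0 < H ξ
  uniformlyConvex : ∃ κ : ℝ, 0 < κ ∧ ∀ ξ, H ξ = 1 → ∀ ζ, inner ℝ (gradient H ξ) ζ = 0 →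
    κ * ‖gradient H ξ‖ * ‖ζ‖ ^ 2 ≤ fderiv ℝ (fderiv ℝ H) ξ ζ ζ

/-- The vector field `a(ξ) = (1/p) ∇(H^p)(ξ)`, so that `Δ_p^H u = div (a(∇u))`. -/
def anisotropicField {n : ℕ} (H : EuclideanSpace ℝ (Fin n) → ℝ) (p : ℝ)
    (ξ : EuclideanSpace ℝ (Fin n)) : EuclideanSpace ℝ (Fin n) :=
  (1 / p) • gradient (fun ζ => H ζ ^ p) ξ

/-- `g` belongs to `L^p_loc(ℝⁿ)`. -/
def MemLpLoc {n : ℕ} {F : Type*} [NormedAddCommGroup F] (p : ℝ)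
    (g : EuclideanSpace ℝ (Fin n) → F) : Prop :=
  ∀ K : Set (EuclideanSpace ℝ (Fin n)), IsCompact K →
    MemLp g (ENNReal.ofReal p) (volume.restrict K)

/-- `G` is the weak gradient of `u`, where both belong to `L^p_loc(ℝⁿ)`; thus
`u ∈ W^{1,p}_loc(ℝⁿ)` means that such a `G` exists, and then `G = ∇u` almost everywhere. -/
structure IsWeakGradientLoc {n : ℕ} (p : ℝ) (u : EuclideanSpace ℝ (Fin n) → ℝ)
    (G : EuclideanSpace ℝ (Fin n) → EuclideanSpace ℝ (Fin n)) : Prop where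
  memLpLoc : MemLpLoc p u
  memLpLoc_grad : MemLpLoc p G
  integral_eq : ∀ φ : EuclideanSpace ℝ (Fin n) → ℝ, ContDiff ℝ ∞ φ → HasCompactSupport φ →
    ∀ i : Fin n, ∫ x, u x * (gradient φ x) i = -∫ x, (G x) i * φ x

/-- `u` is a (weak) subsolution of `-Δ_p^H u = f(u)` in `ℝⁿ`:
`u ∈ W^{1,p}_loc(ℝⁿ) ∩ C(ℝⁿ)` and `∫ a(∇u)·∇φ ≤ ∫ f(u) φ` for all nonnegative
`φ ∈ C_c^∞(ℝⁿ)`. -/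
def IsSubsolution {n : ℕ} (H : EuclideanSpace ℝ (Fin n) → ℝ) (p : ℝ) (f : ℝ → ℝ)
    (u : EuclideanSpace ℝ (Fin n) → ℝ) : Prop :=
  Continuous u ∧
    ∃ G : EuclideanSpace ℝ (Fin n) → EuclideanSpace ℝ (Fin n), IsWeakGradientLoc p u G ∧
      ∀ φ : EuclideanSpace ℝ (Fin n) → ℝ, ContDiff ℝ ∞ φ → HasCompactSupport φ →
        (∀ x, 0 ≤ φ x) →
        ∫ x, inner ℝ (anisotropicField H p (G x)) (gradient φ x) ≤ ∫ x, f (u x) * φ x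

/-- The exponent `p_* = (n - 1) p / (n - p)`, used only for `p < n`. -/
def lowerStarExponent (n : ℕ) (p : ℝ) : ℝ :=
  ((n : ℝ) - 1) * p / ((n : ℝ) - p)

/-- `∫₁^∞ (-f(v))^{-1/q} dv < ∞`, as finiteness of the integral of a nonnegative function. -/
def HasFiniteTailIntegral (f : ℝ → ℝ) (q : ℝ) : Prop :=
  ∫⁻ v in Ioi (1 : ℝ), ENNReal.ofReal ((-f v) ^ (-1 / q)) < ⊤

end

/-! Suppose `u` is a positive subsolution, and write `g = -f > 0` and `s = pq/(q-p+1)`. The tail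
condition makes `Φ(v) = 1 + ∫_v^∞ g^{-1/q}` finite and at least 1 on `(0,∞)`. Test the inequality
with `Φ(u)^{-β} η^k`, where `β = (p-1)q/(q-p+1)` and `η` is a cutoff equal to 1 on the ball of
radius `R` and vanishing outside radius `2R`. Since `Φ' = -g^{-1/q}`, the weight `Φ^{-β}` increases,
and coercivity of `a` yields a good term `X = |∇u|^p β Φ^{-β-1} g^{-1/q} η^k`. The right side
contributes a second good term `Y = g Φ^{-β} η^k`.

The growth bound on `a` makes the cutoff term at most a constant times `|∇u|^{p-1} Φ^{-β} η^{k-1} /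
R`. The exponent `β` is the one for which this factors through `X^α Y^θ / R` with `α + θ < 1`.
Young's inequality absorbs it into `X` and `Y/2`, at the cost of `C R^{-s}` on the ball of radius
`2R`. Hence `∫ Y ≤ C R^{n-s}`. Both alternatives of the theorem give `n < s`, so letting `R → ∞`
contradicts the positivity of `Y` on the unit ball (`not_isSubsolution_of_hasFiniteTailIntegral`).

The test function is not smooth, because `u` is only continuous and in `W^{1,p}_loc`. With the field
`V = a(∇u)` in `L^{p'}_loc` held fixed, the inequality is linear in the test function, so
mollification extends it first to `C¹` test functions (`integral_fderiv_le_of_contDiff_one`) and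
then to `ψ(u) χ` (`IsWeakGradientLoc.integral_comp_mul_le`). -/

theorem norm_inv_norm_smul {F : Type*} [NormedAddCommGroup F] [NormedSpace ℝ F] {x : F}
    (hx : x ≠ 0) : ‖‖x‖⁻¹ • x‖ = 1 := by
  rw [norm_smul, norm_inv, norm_norm, inv_mul_cancel₀ (norm_ne_zero_iff.2 hx)]

/-! ### Growth and coercivity of the field `a`, from homogeneity and compactness of the sphere. -/

namespace IsAnisotropy

variable {n : ℕ} {H : EuclideanSpace ℝ (Fin n) → ℝ}

theorem map_zero (hH : IsAnisotropy H) : H 0 = 0 := by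
  have h := hH.homogeneous 2 two_pos 0
  rw [smul_zero] at h
  linarith

theorem eq_norm_mul (hH : IsAnisotropy H) {ξ : EuclideanSpace ℝ (Fin n)} (hξ : ξ ≠ 0) :
    H ξ = ‖ξ‖ * H (‖ξ‖⁻¹ • ξ) := by
  rw [← hH.homogeneous _ (norm_pos_iff.2 hξ), smul_inv_smul₀ (norm_ne_zero_iff.2 hξ)]

theorem pos (hH : IsAnisotropy H) {ξ : EuclideanSpace ℝ (Fin n)} (hξ : ξ ≠ 0) : 0 < H ξ := by
  rw [hH.eq_norm_mul hξ]
  exact mul_pos (norm_pos_iff.2 hξ) (hH.pos_on_sphere _ (norm_inv_norm_smul hξ))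

theorem nonneg (hH : IsAnisotropy H) (ξ : EuclideanSpace ℝ (Fin n)) : 0 ≤ H ξ := by
  rcases eq_or_ne ξ 0 with rfl | hξ
  · exact hH.map_zero.ge
  · exact (hH.pos hξ).le

theorem exists_le (hH : IsAnisotropy H) : ∃ c : ℝ, 0 < c ∧ ∀ ξ, c * ‖ξ‖ ≤ H ξ := by
  obtain ⟨c, hc, hcH⟩ := (isCompact_sphere (0 : EuclideanSpace ℝ (Fin n)) 1).exists_forall_le'
    hH.continuous.continuousOn (a := 0) fun ξ hξ => hH.pos_on_sphere ξ (by simpa using hξ)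
  refine ⟨c, hc, fun ξ => ?_⟩
  rcases eq_or_ne ξ 0 with rfl | hξ
  · simp [hH.map_zero]
  · rw [hH.eq_norm_mul hξ, mul_comm]
    gcongr
    exact hcH _ (mem_sphere_zero_iff_norm.2 (norm_inv_norm_smul hξ))

theorem rpow_smul (hH : IsAnisotropy H) (p : ℝ) {t : ℝ} (ht : 0 < t)
    (ξ : EuclideanSpace ℝ (Fin n)) : H (t • ξ) ^ p = t ^ p * H ξ ^ p := by
  rw [hH.homogeneous t ht, Real.mul_rpow ht.le (hH.nonneg ξ)]

theorem contDiffOn_rpow (hH : IsAnisotropy H) (p : ℝ) :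
    ContDiffOn ℝ 1 (fun ζ => H ζ ^ p) {0}ᶜ :=
  (hH.contDiffOn.of_le (by norm_num)).rpow_const_of_ne fun _ hξ => (hH.pos hξ).ne'

theorem anisotropicField_zero (hH : IsAnisotropy H) {p : ℝ} (hp : 1 < p) :
    anisotropicField H p 0 = 0 := by
  have hmin : IsLocalMin (fun ζ => H ζ ^ p) 0 := by
    refine Filter.Eventually.of_forall fun ζ => ?_
    simp only [hH.map_zero]
    rw [Real.zero_rpow (by linarith)]
    exact Real.rpow_nonneg (hH.nonneg ζ) p
  simp [anisotropicField, gradient, hmin.fderiv_eq_zero]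

theorem anisotropicField_smul (hH : IsAnisotropy H) (p : ℝ) {t : ℝ} (ht : 0 < t)
    (ξ : EuclideanSpace ℝ (Fin n)) :
    anisotropicField H p (t • ξ) = t ^ (p - 1) • anisotropicField H p ξ := by
  have h1 : fderiv ℝ (fun ζ => H (t • ζ) ^ p) ξ = t • fderiv ℝ (fun ζ => H ζ ^ p) (t • ξ) :=
    fderiv_comp_smul (f := fun ζ => H ζ ^ p) t
  have h2 : (fun ζ => H (t • ζ) ^ p) = fun ζ => t ^ p • H ζ ^ p := by
    ext ζ
    rw [hH.rpow_smul p ht, smul_eq_mul]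
  -- An invertible scalar commutes with `fderiv` without any differentiability, so no case split at
  -- the origin is needed.
  have : Invertible (t ^ p) := invertibleOfNonzero (Real.rpow_pos_of_pos ht p).ne'
  rw [h2, show (fun ζ => t ^ p • H ζ ^ p) = t ^ p • fun ζ => H ζ ^ p from rfl,
    fderiv_const_smul_of_invertible] at h1
  have h3 : fderiv ℝ (fun ζ => H ζ ^ p) (t • ξ) = t ^ (p - 1) • fderiv ℝ (fun ζ => H ζ ^ p) ξ := by
    rw [← inv_smul_smul₀ ht.ne' (fderiv ℝ (fun ζ => H ζ ^ p) (t • ξ)), ← h1, smul_smul, Real.rpow_sub_one ht.ne', div_eq_inv_mul]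
  simp only [anisotropicField, gradient, h3, map_smul, smul_comm (1 / p)]

/-- Euler's identity for the `p`-homogeneous function `H^p`: differentiate `t ↦ H(tξ)^p = t^p
H(ξ)^p` at `t = 1`. -/
theorem inner_anisotropicField_self (hH : IsAnisotropy H) {p : ℝ} (hp : 1 < p)
    (ξ : EuclideanSpace ℝ (Fin n)) : inner ℝ (anisotropicField H p ξ) ξ = H ξ ^ p := by
  have hp0 : p ≠ 0 := by linarith
  rcases eq_or_ne ξ 0 with rfl | hξ
  · rw [inner_zero_right, hH.map_zero, Real.zero_rpow hp0]
  have hd : DifferentiableAt ℝ (fun ζ => H ζ ^ p) ((1 : ℝ) • ξ) := by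
    rw [one_smul]
    exact ((hH.contDiffOn_rpow p).differentiableOn one_ne_zero).differentiableAt
      (isOpen_compl_singleton.mem_nhds hξ)
  have h1 : HasDerivAt (fun t : ℝ => H (t • ξ) ^ p)
      (fderiv ℝ (fun ζ => H ζ ^ p) ((1 : ℝ) • ξ) ((1 : ℝ) • ξ)) 1 :=
    HasFDerivAt.comp_hasDerivAt (f := fun t : ℝ => t • ξ) (1 : ℝ) hd.hasFDerivAt
      ((hasDerivAt_id (1 : ℝ)).smul_const ξ)
  have h2 : HasDerivAt (fun t : ℝ => t ^ p * H ξ ^ p) (p * 1 ^ (p - 1) * H ξ ^ p) 1 :=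
    (Real.hasDerivAt_rpow_const (Or.inl one_ne_zero)).mul_const _
  have h3 := h1.unique (h2.congr_of_eventuallyEq
    ((eventually_gt_nhds zero_lt_one).mono fun t ht => hH.rpow_smul p ht ξ))
  rw [one_smul, Real.one_rpow, mul_one] at h3
  rw [anisotropicField, real_inner_smul_left, gradient, InnerProductSpace.toDual_symm_apply, h3]
  field_simp

theorem exists_norm_anisotropicField_le (hH : IsAnisotropy H) {p : ℝ} (hp : 1 < p) :
    ∃ C : ℝ, 0 ≤ C ∧ ∀ ξ, ‖anisotropicField H p ξ‖ ≤ C * ‖ξ‖ ^ (p - 1) := by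
  have hcont : ContinuousOn (anisotropicField H p) (Metric.sphere 0 1) := by
    refine ContinuousOn.mono (s := {0}ᶜ) ?_ fun ξ hξ => Metric.ne_of_mem_sphere hξ one_ne_zero
    have h := (hH.contDiffOn_rpow p).continuousOn_fderiv_of_isOpen isOpen_compl_singleton le_rfl
    exact ((LinearIsometryEquiv.continuous _).comp_continuousOn h).const_smul (1 / p)
  obtain ⟨C, hC⟩ := (isCompact_sphere _ _).exists_bound_of_continuousOn hcont
  refine ⟨max C 0, le_max_right _ _, fun ξ => ?_⟩
  rcases eq_or_ne ξ 0 with rfl | hξ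
  · rw [hH.anisotropicField_zero hp, norm_zero]
    positivity
  have hξ' := norm_pos_iff.2 hξ
  have h := hH.anisotropicField_smul p hξ' (‖ξ‖⁻¹ • ξ)
  rw [smul_inv_smul₀ hξ'.ne'] at h
  rw [h, norm_smul, Real.norm_of_nonneg (by positivity), mul_comm]
  gcongr
  exact (hC _ (mem_sphere_zero_iff_norm.2 (norm_inv_norm_smul hξ))).trans (le_max_left _ _)

theorem exists_le_inner_anisotropicField (hH : IsAnisotropy H) {p : ℝ} (hp : 1 < p) :
    ∃ c : ℝ, 0 < c ∧ ∀ ξ, c * ‖ξ‖ ^ p ≤ inner ℝ (anisotropicField H p ξ) ξ := by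
  obtain ⟨c, hc, hcH⟩ := hH.exists_le
  refine ⟨c ^ p, by positivity, fun ξ => ?_⟩
  rw [hH.inner_anisotropicField_self hp, ← Real.mul_rpow hc.le (norm_nonneg ξ)]
  exact Real.rpow_le_rpow (by positivity) (hcH ξ) (by linarith)

end IsAnisotropy

theorem measurable_anisotropicField {n : ℕ} (H : EuclideanSpace ℝ (Fin n) → ℝ) (p : ℝ) :
    Measurable (anisotropicField H p) :=
  ((LinearIsometryEquiv.continuous _).measurable.comp (measurable_fderiv ℝ _)).const_smul (1 / p)

/-! ### Convergence of mollifications in `L^p`. -/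

section Mollification

open Filter Topology Metric ContinuousLinearMap
open scoped Convolution ENNReal

variable {E F : Type*} [NormedAddCommGroup E] [NormedSpace ℝ E] [FiniteDimensional ℝ E]
  [MeasurableSpace E] [BorelSpace E] {μ : Measure E} [μ.IsAddHaarMeasure]
  [NormedAddCommGroup F]

theorem MeasureTheory.MemLp.tendsto_eLpNorm_comp_sub_sub {g : E → F} {p : ℝ≥0∞} (hp1 : 1 ≤ p)
    (hp : p ≠ ⊤) (hg : MemLp g p μ) :
    Tendsto (fun z => eLpNorm ((fun x => g (x - z)) - g) p μ) (𝓝 0) (𝓝 0) := by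
  have : Fact (1 ≤ p) := ⟨hp1⟩
  let τ : C(E, C(E, E)) := ContinuousMap.curry ⟨fun q : E × E => q.2 - q.1, by fun_prop⟩
  have hτ (z : E) : MeasurePreserving (τ z) μ μ := measurePreserving_sub_right μ z
  have h := Tendsto.compMeasurePreservingLp (tendsto_const_nhds (x := hg.toLp g))
    (τ.continuous.tendsto 0) hτ (hτ 0) hp
  simp only [Lp.toLp_compMeasurePreserving] at h
  rw [Lp.tendsto_Lp_iff_tendsto_eLpNorm''] at h
  simpa [τ, Function.comp_def] using h

variable [NormedSpace ℝ F] [CompleteSpace F]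

/-- The mollification error at `x` is an average of `g(x - z) - g(x)` over the bump. Jensen's
inequality moves the `p`-th power inside the average, and Tonelli then reduces the claim to single
translations. -/
theorem ContDiffBump.eLpNorm_convolution_sub_le (φ : ContDiffBump (0 : E)) {g : E → F} {p : ℝ≥0∞}
    (hp1 : 1 ≤ p) (hp : p ≠ ⊤) (hg : MemLp g p μ) {δ : ℝ≥0∞}
    (hδ : ∀ z ∈ ball (0 : E) φ.rOut, eLpNorm ((fun x => g (x - z)) - g) p μ ≤ δ) :
    eLpNorm ((φ.normed μ ⋆[lsmul ℝ ℝ, μ] g) - g) p μ ≤ δ := by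
  have hp0 : p ≠ 0 := (one_pos.trans_le hp1).ne'
  have hP : 0 < p.toReal := ENNReal.toReal_pos hp0 hp
  -- With the bump as the density of a probability measure, Jensen becomes monotonicity of `L^p`
  -- norms in `p`.
  set ν : Measure E := μ.withDensity fun z => ENNReal.ofReal (φ.normed μ z) with hν
  have hρm : Measurable fun z => ENNReal.ofReal (φ.normed μ z) :=
    (φ.continuous_normed.measurable).ennreal_ofReal
  have : IsProbabilityMeasure ν := by
    constructor
    rw [hν, withDensity_apply _ MeasurableSet.univ, setLIntegral_univ, ← ofReal_integral_eq_lintegral_ofReal φ.integrable_normed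
      (ae_of_all _ φ.nonneg_normed), φ.integral_normed, ENNReal.ofReal_one]
  have hνμ : ν ≪ μ := withDensity_absolutelyContinuous _ _
  have hball : ∀ᵐ z ∂ν, z ∈ ball (0 : E) φ.rOut := by
    rw [hν, ae_withDensity_iff hρm]
    refine ae_of_all _ fun z hz => ?_
    rw [← φ.support_normed_eq (μ := μ)]
    intro h0
    simp [h0] at hz
  have hgl : LocallyIntegrable g μ := hg.locallyIntegrable hp1
  have hm : AEStronglyMeasurable (fun q : E × E => g (q.1 - q.2) - g q.1) (μ.prod ν) := by
    refine AEStronglyMeasurable.sub ?_ hg.1.comp_fst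
    exact hg.1.comp_quasiMeasurePreserving
      ((quasiMeasurePreserving_sub_of_right_invariant μ μ).mono
        (Measure.AbsolutelyContinuous.rfl.prod hνμ) Measure.AbsolutelyContinuous.rfl)
  have hpt (x : E) : ‖((φ.normed μ ⋆[lsmul ℝ ℝ, μ] g) - g) x‖ₑ ^ p.toReal ≤
      ∫⁻ z, ‖g (x - z) - g x‖ₑ ^ p.toReal ∂ν := by
    have hmx : AEStronglyMeasurable (fun z => g (x - z) - g x) ν :=
      ((hg.1.comp_quasiMeasurePreserving
        (quasiMeasurePreserving_sub_left_of_right_invariant μ x)).mono_ac hνμ).sub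
        aestronglyMeasurable_const
    have h1 : ((φ.normed μ ⋆[lsmul ℝ ℝ, μ] g) - g) x =
        ∫ z, φ.normed μ z • (g (x - z) - g x) ∂μ := by
      have hi1 : Integrable (fun z => φ.normed μ z • g (x - z)) μ :=
        φ.hasCompactSupport_normed.convolutionExists_left (lsmul ℝ ℝ) φ.continuous_normed hgl x
      have hi2 : Integrable (fun z => φ.normed μ z • g x) μ := φ.integrable_normed.smul_const _
      simp only [smul_sub]
      rw [integral_sub hi1 hi2, φ.integral_normed_smul]
      rfl
    have h2 : ‖((φ.normed μ ⋆[lsmul ℝ ℝ, μ] g) - g) x‖ₑ ≤ eLpNorm (fun z => g (x - z) - g x) 1 ν := by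
      rw [h1, eLpNorm_one_eq_lintegral_enorm, hν, lintegral_withDensity_eq_lintegral_mul₀' hρm.aemeasurable]
      · refine (enorm_integral_le_lintegral_enorm _).trans_eq ?_
        simp [enorm_smul, Real.enorm_of_nonneg (φ.nonneg_normed _)]
      · exact hmx.enorm
    calc _ ≤ eLpNorm (fun z => g (x - z) - g x) p ν ^ p.toReal := by
          gcongr
          exact h2.trans (eLpNorm_le_eLpNorm_of_exponent_le hp1 hmx)
      _ = _ := by
          rw [eLpNorm_eq_lintegral_rpow_enorm_toReal hp0 hp, one_div, ENNReal.rpow_inv_rpow hP.ne']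
  rw [eLpNorm_eq_lintegral_rpow_enorm_toReal hp0 hp, one_div, ENNReal.rpow_inv_le_iff hP]
  calc _ ≤ ∫⁻ x, ∫⁻ z, ‖g (x - z) - g x‖ₑ ^ p.toReal ∂ν ∂μ := lintegral_mono hpt
    _ = ∫⁻ z, ∫⁻ x, ‖g (x - z) - g x‖ₑ ^ p.toReal ∂μ ∂ν :=
        lintegral_lintegral_swap (hm.enorm.pow_const _)
    _ ≤ ∫⁻ _, δ ^ p.toReal ∂ν := by
        refine lintegral_mono_ae (hball.mono fun z hz => ?_)
        have h := hδ z hz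
        rwa [eLpNorm_eq_lintegral_rpow_enorm_toReal hp0 hp, one_div, ENNReal.rpow_inv_le_iff hP] at h
    _ = δ ^ p.toReal := by simp

theorem ContDiffBump.tendsto_eLpNorm_convolution_sub {ι : Type*} {l : Filter ι}
    {φ : ι → ContDiffBump (0 : E)} (hφ : Tendsto (fun i => (φ i).rOut) l (𝓝 0))
    {g : E → F} {p : ℝ≥0∞} (hp1 : 1 ≤ p) (hp : p ≠ ⊤) (hg : MemLp g p μ) :
    Tendsto (fun i => eLpNorm (((φ i).normed μ ⋆[lsmul ℝ ℝ, μ] g) - g) p μ) l (𝓝 0) := by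
  rw [ENNReal.tendsto_nhds_zero]
  intro ε hε
  obtain ⟨r, hr, hball⟩ := Metric.eventually_nhds_iff_ball.1
    (ENNReal.tendsto_nhds_zero.1 (hg.tendsto_eLpNorm_comp_sub_sub hp1 hp) ε hε)
  filter_upwards [hφ.eventually_lt_const hr] with i hi
  exact (φ i).eLpNorm_convolution_sub_le hp1 hp hg fun z hz => hball z (ball_subset_ball hi.le hz)

end Mollification

/-! ### Extending a linear differential inequality from smooth to `C¹` test functions. -/

section Mollification

open Filter Topology Metric ContinuousLinearMap
open scoped Convolution ENNReal

/-- A sequence of bump functions whose supports shrink to the origin. -/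
noncomputable def shrinkingBump (E : Type*) [NormedAddCommGroup E] (j : ℕ) :
    ContDiffBump (0 : E) where
  rIn := 1 / (j + 1) / 2
  rOut := 1 / (j + 1)
  rIn_pos := by positivity
  rIn_lt_rOut := half_lt_self (by positivity)

theorem tendsto_shrinkingBump_rOut {E : Type*} [NormedAddCommGroup E] :
    Tendsto (fun j => (shrinkingBump E j).rOut) atTop (𝓝 0) :=
  tendsto_one_div_add_atTop_nhds_zero_nat

theorem shrinkingBump_rOut_le {E : Type*} [NormedAddCommGroup E] (j : ℕ) : (shrinkingBump E j).rOut ≤ 1 := by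
  have : (0 : ℝ) ≤ j := j.cast_nonneg
  exact div_le_one_of_le₀ (by linarith) (by linarith)

variable {E F : Type*} [NormedAddCommGroup E] [NormedSpace ℝ E] [FiniteDimensional ℝ E]
  [MeasurableSpace E] [BorelSpace E] {μ : Measure E} [μ.IsAddHaarMeasure]
  [NormedAddCommGroup F] [NormedSpace ℝ F] [CompleteSpace F]

theorem ContDiffBump.convolution_normed_eq_zero (φ : ContDiffBump (0 : E)) (hφ : φ.rOut ≤ 1)
    {g : E → F} {x : E} (hx : x ∉ cthickening 1 (tsupport g)) :
    (φ.normed μ ⋆[lsmul ℝ ℝ, μ] g : E → F) x = 0 := by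
  have h0 : ∀ y ∈ ball x φ.rOut, g y = 0 := by
    intro y hy
    by_contra hgy
    exact hx (mem_cthickening_of_dist_le x y 1 _ (subset_tsupport g hgy)
      ((dist_comm x y).trans_le ((mem_ball.1 hy).le.trans hφ)))
  rw [φ.normed_convolution_eq_right fun y hy => (h0 y hy).trans (h0 x (mem_ball_self φ.rOut_pos)).symm,
    h0 x (mem_ball_self φ.rOut_pos)]

theorem ContDiffBump.norm_convolution_normed_le (φ : ContDiffBump (0 : E)) {g : E → F}
    (hg : AEStronglyMeasurable g μ) {M : ℝ} (hM : ∀ x, ‖g x‖ ≤ M) (x : E) :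
    ‖(φ.normed μ ⋆[lsmul ℝ ℝ, μ] g : E → F) x‖ ≤ M := by
  rw [← dist_zero_right]
  exact dist_convolution_le ((norm_nonneg _).trans (hM x)) φ.support_normed_eq.subset
    φ.nonneg_normed φ.integral_normed hg fun y _ => (dist_zero_right _).trans_le (hM y)

theorem ContDiffBump.convolution_normed_mem_Icc (φ : ContDiffBump (0 : E)) {g : E → ℝ}
    (hg : AEStronglyMeasurable g μ) {a b : ℝ} {x : E} (hab : ∀ y ∈ ball x φ.rOut, g y ∈ Icc a b) :
    (φ.normed μ ⋆[lsmul ℝ ℝ, μ] g : E → ℝ) x ∈ Icc a b := by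
  have hx := hab x (mem_ball_self φ.rOut_pos)
  rw [Real.Icc_eq_closedBall, mem_closedBall] at hx ⊢
  exact dist_convolution_le (dist_nonneg.trans hx) φ.support_normed_eq.subset
    φ.nonneg_normed φ.integral_normed hg fun y hy => by
      rw [← mem_closedBall, ← Real.Icc_eq_closedBall]
      exact hab y hy

theorem ContDiffBump.hasFDerivAt_convolution_normed (φ : ContDiffBump (0 : E)) {g : E → ℝ}
    (hg : ContDiff ℝ 1 g) (hgc : HasCompactSupport g) (x : E) :
    HasFDerivAt (φ.normed μ ⋆[lsmul ℝ ℝ, μ] g : E → ℝ)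
      ((φ.normed μ ⋆[lsmul ℝ ℝ, μ] fderiv ℝ g : E → E →L[ℝ] ℝ) x) x :=
  hgc.hasFDerivAt_convolution_right (lsmul ℝ ℝ)
    φ.continuous_normed.locallyIntegrable hg x

/-- A linear differential inequality tested by smooth functions may be tested by `C¹` functions. -/
theorem integral_fderiv_le_of_contDiff_one {V : E → E} {h : E → ℝ}
    (hV : LocallyIntegrable V μ) (hh : Continuous h)
    (hineq : ∀ φ : E → ℝ, ContDiff ℝ ∞ φ → HasCompactSupport φ → (∀ x, 0 ≤ φ x) →
      ∫ x, fderiv ℝ φ x (V x) ∂μ ≤ ∫ x, h x * φ x ∂μ)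
    {φ : E → ℝ} (hφ : ContDiff ℝ 1 φ) (hφc : HasCompactSupport φ) (hφ0 : ∀ x, 0 ≤ φ x) :
    ∫ x, fderiv ℝ φ x (V x) ∂μ ≤ ∫ x, h x * φ x ∂μ := by
  set ρ : ℕ → E → ℝ := fun j => (shrinkingBump E j).normed μ with hρ
  set Φ : ℕ → E → ℝ := fun j => ρ j ⋆[lsmul ℝ ℝ, μ] φ with hΦ
  -- All bump radii are at most 1, so this one compact set carries every mollification and its
  -- derivative.
  set K := cthickening 1 (tsupport φ) with hKdef
  have hK : IsCompact K := hφc.isCompact.cthickening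
  have hφ' : Continuous (fderiv ℝ φ) := hφ.continuous_fderiv one_ne_zero
  have hsmooth (j : ℕ) : ContDiff ℝ ∞ (Φ j) :=
    (shrinkingBump E j).hasCompactSupport_normed.contDiff_convolution_left (lsmul ℝ ℝ)
      (shrinkingBump E j).contDiff_normed hφ.continuous.locallyIntegrable
  have hfd (j : ℕ) (x : E) :
      fderiv ℝ (Φ j) x = (ρ j ⋆[lsmul ℝ ℝ, μ] fderiv ℝ φ : E → E →L[ℝ] ℝ) x :=
    ((shrinkingBump E j).hasFDerivAt_convolution_normed hφ hφc x).fderiv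
  have hzero (j : ℕ) (x : E) (hx : x ∉ K) : Φ j x = 0 :=
    (shrinkingBump E j).convolution_normed_eq_zero (shrinkingBump_rOut_le j) hx
  have hzero' (j : ℕ) (x : E) (hx : x ∉ K) : fderiv ℝ (Φ j) x = 0 := by
    rw [hfd]
    refine (shrinkingBump E j).convolution_normed_eq_zero (shrinkingBump_rOut_le j) fun h => hx ?_
    exact cthickening_subset_of_subset 1 (tsupport_fderiv_subset ℝ) h
  obtain ⟨M, hM⟩ := hφ.continuous.bounded_above_of_compact_support hφc
  obtain ⟨M', hM'⟩ := hφ'.bounded_above_of_compact_support (hφc.fderiv ℝ)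
  have hj (j : ℕ) : ∫ x, fderiv ℝ (Φ j) x (V x) ∂μ ≤ ∫ x, h x * Φ j x ∂μ := by
    refine hineq _ (hsmooth j) (HasCompactSupport.intro hK (hzero j)) fun x => ?_
    exact integral_nonneg fun t => mul_nonneg ((shrinkingBump E j).nonneg_normed t) (hφ0 _)
  refine le_of_tendsto_of_tendsto' (b := atTop) ?_ ?_ hj
  · refine tendsto_integral_of_dominated_convergence (K.indicator fun x => M' * ‖V x‖) ?_ ?_ ?_ ?_
    · intro j
      exact (ContinuousLinearMap.id ℝ (E →L[ℝ] ℝ)).aestronglyMeasurable_comp₂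
        ((hsmooth j).continuous_fderiv (by simp)).aestronglyMeasurable hV.aestronglyMeasurable
    · rw [integrable_indicator_iff hK.measurableSet]
      exact (hV.integrableOn_isCompact hK).norm.const_mul _
    · refine fun j => ae_of_all _ fun x => ?_
      by_cases hx : x ∈ K
      · rw [indicator_of_mem hx]
        refine (le_opNorm _ _).trans ?_
        gcongr
        rw [hfd]
        exact (shrinkingBump E j).norm_convolution_normed_le hφ'.aestronglyMeasurable hM' x
      · simp [hx, hzero' j x hx]
    · refine ae_of_all _ fun x => ?_
      simp only [hfd]
      exact ((ContinuousLinearMap.apply ℝ ℝ (V x)).continuous.tendsto _).comp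
        (ContDiffBump.convolution_tendsto_right_of_continuous tendsto_shrinkingBump_rOut hφ' x)
  · refine tendsto_integral_of_dominated_convergence (K.indicator fun x => ‖h x‖ * M) ?_ ?_ ?_ ?_
    · exact fun j => (hh.mul (hsmooth j).continuous).aestronglyMeasurable
    · rw [integrable_indicator_iff hK.measurableSet]
      exact ((hh.norm.mul continuous_const).continuousOn).integrableOn_compact hK
    · refine fun j => ae_of_all _ fun x => ?_
      by_cases hx : x ∈ K
      · rw [indicator_of_mem hx, norm_mul]
        gcongr
        exact (shrinkingBump E j).norm_convolution_normed_le hφ.continuous.aestronglyMeasurable hM x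
      · simp [hx, hzero j x hx]
    · refine ae_of_all _ fun x => ?_
      exact (ContDiffBump.convolution_tendsto_right_of_continuous tendsto_shrinkingBump_rOut
        hφ.continuous x).const_mul _

end Mollification

/-! ### Mollification commutes with the weak gradient. -/

section WeakGradient

open Filter Topology Metric ContinuousLinearMap
open scoped Convolution ENNReal

variable {n : ℕ}

theorem gradient_apply_eq_fderiv_single (φ : EuclideanSpace ℝ (Fin n) → ℝ)
    (x : EuclideanSpace ℝ (Fin n)) (i : Fin n) :
    gradient φ x i = fderiv ℝ φ x (EuclideanSpace.single i 1) := by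
  rw [← InnerProductSpace.toDual_symm_apply (x := EuclideanSpace.single i 1), gradient,
    EuclideanSpace.inner_single_right]
  simp

theorem MemLpLoc.locallyIntegrable {F : Type*} [NormedAddCommGroup F] {p : ℝ} (hp : 1 ≤ p)
    {g : EuclideanSpace ℝ (Fin n) → F} (hg : MemLpLoc p g) : LocallyIntegrable g := by
  rw [locallyIntegrable_iff]
  intro K hK
  have : IsFiniteMeasure (volume.restrict K) := ⟨by simpa using hK.measure_lt_top⟩
  exact (hg K hK).integrable (by simpa using hp)

/-- Put the derivative on `ρ` and use `y ↦ ρ(x - y)` as test function for the weak gradient; the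
sign from reflecting `ρ` cancels the one from integration by parts. -/
theorem IsWeakGradientLoc.gradient_convolution {p : ℝ} (hp : 1 ≤ p)
    {u : EuclideanSpace ℝ (Fin n) → ℝ} {G : EuclideanSpace ℝ (Fin n) → EuclideanSpace ℝ (Fin n)}
    (h : IsWeakGradientLoc p u G) {ρ : EuclideanSpace ℝ (Fin n) → ℝ} (hρ : ContDiff ℝ ∞ ρ)
    (hρc : HasCompactSupport ρ) (x : EuclideanSpace ℝ (Fin n)) :
    gradient (ρ ⋆[lsmul ℝ ℝ, volume] u) x = (ρ ⋆[lsmul ℝ ℝ, volume] G) x := by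
  have hu := h.memLpLoc.locallyIntegrable hp
  have hG := h.memLpLoc_grad.locallyIntegrable hp
  have hρ1 : ContDiff ℝ 1 ρ := hρ.of_le (by simp)
  have hfd := (hρc.hasFDerivAt_convolution_left (lsmul ℝ ℝ) hρ1 hu x).fderiv
  ext i
  set e : EuclideanSpace ℝ (Fin n) := EuclideanSpace.single i 1 with he
  have hφ : ContDiff ℝ ∞ fun y => ρ (x - y) := hρ.comp (contDiff_const.sub contDiff_id)
  have hφc : HasCompactSupport fun y => ρ (x - y) :=
    hρc.comp_homeomorph (Homeomorph.subLeft x)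
  have hgr (y : EuclideanSpace ℝ (Fin n)) :
      gradient (fun y => ρ (x - y)) y i = -(fderiv ℝ ρ (x - y) e) := by
    rw [gradient_apply_eq_fderiv_single]
    have h1 : HasFDerivAt (fun y => ρ (x - y)) _ y :=
      HasFDerivAt.comp y (hρ1.differentiable one_ne_zero (x - y)).hasFDerivAt
        ((hasFDerivAt_id y).const_sub x)
    rw [h1.fderiv]
    simp [he]
  have hw := h.integral_eq _ hφ hφc i
  simp only [hgr, mul_neg, integral_neg, neg_inj] at hw
  have hint1 : Integrable (fun t => (lsmul ℝ ℝ).precompL (EuclideanSpace ℝ (Fin n))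
      (fderiv ℝ ρ t) (u (x - t))) :=
    (hρc.fderiv ℝ).convolutionExists_left _ (hρ1.continuous_fderiv one_ne_zero) hu x
  have hint2 : Integrable (fun t => lsmul ℝ ℝ (ρ t) (G (x - t))) :=
    hρc.convolutionExists_left _ hρ1.continuous hG x
  rw [gradient_apply_eq_fderiv_single, hfd]
  calc _ = ∫ t, (lsmul ℝ ℝ).precompL (EuclideanSpace ℝ (Fin n))
            (fderiv ℝ ρ t) (u (x - t)) e := integral_apply hint1 e
    _ = ∫ y, u y * fderiv ℝ ρ (x - y) e := by
        rw [← integral_sub_left_eq_self _ volume x]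
        simp [precompL_apply, mul_comm]
    _ = ∫ y, G y i * ρ (x - y) := hw
    _ = ∫ t, EuclideanSpace.proj (𝕜 := ℝ) i (lsmul ℝ ℝ (ρ t) (G (x - t))) := by
        rw [← integral_sub_left_eq_self _ volume x]
        simp [mul_comm]
    _ = _ := (EuclideanSpace.proj (𝕜 := ℝ) i).integral_comp_comm hint2

end WeakGradient

/-! ### Nonlinear test functions `ψ(u) χ`. -/

section ChainRule

open Filter Topology Metric ContinuousLinearMap
open scoped Convolution ENNReal

theorem tendsto_integral_mul_inner_zero {α E : Type*} [MeasurableSpace α] {ν : Measure α}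
    [NormedAddCommGroup E] [InnerProductSpace ℝ E] {p q : ℝ≥0∞} [p.HolderConjugate q]
    {V : α → E} (hV : MemLp V q ν) {D : ℕ → α → E} (hDm : ∀ j, AEStronglyMeasurable (D j) ν)
    (hD : Tendsto (fun j => eLpNorm (D j) p ν) atTop (𝓝 0)) {w : ℕ → α → ℝ} {B : ℝ}
    (hw : ∀ j, ∀ᵐ x ∂ν, |w j x| ≤ B) :
    Tendsto (fun j => ∫ x, w j x * inner ℝ (D j x) (V x) ∂ν) atTop (𝓝 0) := by
  have hle (j : ℕ) : ‖∫ x, w j x * inner ℝ (D j x) (V x) ∂ν‖ₑ ≤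
      ENNReal.ofReal B * (eLpNorm (D j) p ν * eLpNorm V q ν) := by
    calc _ ≤ ∫⁻ x, ‖w j x * inner ℝ (D j x) (V x)‖ₑ ∂ν := enorm_integral_le_lintegral_enorm _
      _ ≤ ∫⁻ x, ENNReal.ofReal B * ‖(inner ℝ (D j x) (V x) : ℝ)‖ₑ ∂ν := by
          refine lintegral_mono_ae ((hw j).mono fun x hx => ?_)
          rw [enorm_mul]
          gcongr
          rw [Real.enorm_eq_ofReal_abs]
          exact ENNReal.ofReal_le_ofReal hx
      _ = ENNReal.ofReal B * eLpNorm (fun x => (inner ℝ (D j x) (V x) : ℝ)) 1 ν := by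
          rw [lintegral_const_mul' _ _ ENNReal.ofReal_ne_top, eLpNorm_one_eq_lintegral_enorm]
      _ ≤ _ := by
          gcongr
          simpa using eLpNorm_le_eLpNorm_mul_eLpNorm'_of_norm (p := p) (q := q) (r := 1) (hDm j)
            hV.1 (fun a b => (inner ℝ a b : ℝ)) 1 (ae_of_all _ fun x => by
              simpa using norm_inner_le_norm (𝕜 := ℝ) (D j x) (V x))
  have h0 : Tendsto (fun j => ENNReal.ofReal B * (eLpNorm (D j) p ν * eLpNorm V q ν)) atTop
      (𝓝 0) := by
    simpa using ENNReal.Tendsto.const_mul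
      (ENNReal.Tendsto.mul_const hD (Or.inr hV.eLpNorm_ne_top)) (Or.inr ENNReal.ofReal_ne_top)
  exact tendsto_zero_iff_enorm_tendsto_zero.2
    (tendsto_of_tendsto_of_tendsto_of_le_of_le tendsto_const_nhds h0 (fun _ => zero_le) hle)

variable {n : ℕ}

theorem IsWeakGradientLoc.tendsto_eLpNorm_gradient_convolution_sub {p : ℝ} (hp : 1 ≤ p)
    {u : EuclideanSpace ℝ (Fin n) → ℝ} {G : EuclideanSpace ℝ (Fin n) → EuclideanSpace ℝ (Fin n)}
    (h : IsWeakGradientLoc p u G) {K : Set (EuclideanSpace ℝ (Fin n))} (hK : IsCompact K) :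
    Tendsto (fun j => eLpNorm (gradient ((shrinkingBump (EuclideanSpace ℝ (Fin n)) j).normed volume
      ⋆[lsmul ℝ ℝ, volume] u) - G) (ENNReal.ofReal p) (volume.restrict K)) atTop (𝓝 0) := by
  set K₁ := cthickening 1 K with hK₁
  have hK₁c : IsCompact K₁ := hK.cthickening
  -- `G` is only locally in `L^p`. Truncating it to the 1-thickening makes it globally so, and
  -- leaves its mollifications unchanged on `K`.
  have hg : MemLp (K₁.indicator G) (ENNReal.ofReal p) volume :=
    (memLp_indicator_iff_restrict hK₁c.measurableSet).2 (h.memLpLoc_grad K₁ hK₁c)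
  have h0 := ContDiffBump.tendsto_eLpNorm_convolution_sub
    (tendsto_shrinkingBump_rOut (E := EuclideanSpace ℝ (Fin n))) (by simpa using hp)
    ENNReal.ofReal_ne_top hg
  refine tendsto_of_tendsto_of_tendsto_of_le_of_le tendsto_const_nhds h0 (fun _ => zero_le)
    fun j => ?_
  refine le_trans (eLpNorm_congr_ae ?_).le (eLpNorm_mono_measure _ Measure.restrict_le_self)
  refine (ae_restrict_mem hK.measurableSet).mono fun x hx => ?_
  set φ := shrinkingBump (EuclideanSpace ℝ (Fin n)) j
  simp only [Pi.sub_apply]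
  rw [h.gradient_convolution hp φ.contDiff_normed φ.hasCompactSupport_normed,
    indicator_of_mem (self_subset_cthickening K hx)]
  congr 1
  refine integral_congr_ae (ae_of_all _ fun t => ?_)
  by_cases ht : t ∈ ball (0 : EuclideanSpace ℝ (Fin n)) φ.rOut
  · have : x - t ∈ K₁ := by
      refine mem_cthickening_of_dist_le _ x _ _ hx ?_
      rw [dist_eq_norm, sub_sub_cancel_left, norm_neg]
      exact (mem_ball_zero_iff.1 ht).le.trans (shrinkingBump_rOut_le j)
    simp [indicator_of_mem this]
  · rw [← φ.support_normed_eq (μ := volume), Function.notMem_support] at ht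
    simp [ht]

/-- In a weak differential inequality for `u` one may test with `ψ(u) χ`. -/
theorem IsWeakGradientLoc.integral_comp_mul_le {p : ℝ} (hp : 1 < p)
    {u : EuclideanSpace ℝ (Fin n) → ℝ} {G V : EuclideanSpace ℝ (Fin n) → EuclideanSpace ℝ (Fin n)}
    (hG : IsWeakGradientLoc p u G) (hu : Continuous u) (hu0 : ∀ x, 0 < u x)
    (hV : MemLpLoc (p / (p - 1)) V) {h : EuclideanSpace ℝ (Fin n) → ℝ} (hh : Continuous h)
    (hineq : ∀ φ : EuclideanSpace ℝ (Fin n) → ℝ, ContDiff ℝ ∞ φ → HasCompactSupport φ →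
      (∀ x, 0 ≤ φ x) → ∫ x, fderiv ℝ φ x (V x) ≤ ∫ x, h x * φ x)
    {ψ ψ' : ℝ → ℝ} (hψ : ∀ v, 0 < v → HasDerivAt ψ (ψ' v) v) (hψ' : ContinuousOn ψ' (Ioi 0))
    (hψ0 : ∀ v, 0 < v → 0 ≤ ψ v) {χ : EuclideanSpace ℝ (Fin n) → ℝ} (hχ : ContDiff ℝ 1 χ)
    (hχc : HasCompactSupport χ) (hχ0 : ∀ x, 0 ≤ χ x) :
    Integrable (fun x => ψ (u x) * fderiv ℝ χ x (V x) + χ x * ψ' (u x) * inner ℝ (G x) (V x)) ∧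
    ∫ x, (ψ (u x) * fderiv ℝ χ x (V x) + χ x * ψ' (u x) * inner ℝ (G x) (V x)) ≤
      ∫ x, h x * (ψ (u x) * χ x) := by
  have hpq : p.HolderConjugate (p / (p - 1)) := Real.HolderConjugate.conjExponent hp
  have := hpq.ennrealOfReal
  set K := tsupport χ with hKdef
  have hK : IsCompact K := hχc.isCompact
  set K₁ := cthickening 1 K with hK₁def
  have hK₁ : IsCompact K₁ := hK.cthickening
  set ρ : ℕ → EuclideanSpace ℝ (Fin n) → ℝ :=
    fun j => (shrinkingBump (EuclideanSpace ℝ (Fin n)) j).normed volume with hρ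
  set U : ℕ → EuclideanSpace ℝ (Fin n) → ℝ := fun j => ρ j ⋆[lsmul ℝ ℝ, volume] u with hU
  have hUs (j : ℕ) : ContDiff ℝ 1 (U j) :=
    (shrinkingBump _ j).hasCompactSupport_normed.contDiff_convolution_left (lsmul ℝ ℝ)
      (shrinkingBump _ j).contDiff_normed hu.locallyIntegrable
  have hUlim (x : EuclideanSpace ℝ (Fin n)) : Tendsto (fun j => U j x) atTop (𝓝 (u x)) :=
    ContDiffBump.convolution_tendsto_right_of_continuous tendsto_shrinkingBump_rOut hu x
  -- Averages of `u` stay between its extremes on the 1-thickening. So on compacts all `U j` lie in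
  -- one interval away from 0, where `ψ` and `ψ'` are bounded.
  have hUIcc {S : Set (EuclideanSpace ℝ (Fin n))} (hS : IsCompact S) :
      ∃ a b : ℝ, 0 < a ∧ ∀ x ∈ S, u x ∈ Icc a b ∧ ∀ j, U j x ∈ Icc a b := by
    have hS' : IsCompact (cthickening 1 S) := hS.cthickening
    obtain ⟨a, ha, hau⟩ := hS'.exists_forall_le' hu.continuousOn (a := 0) fun x _ => hu0 x
    obtain ⟨b, hb⟩ := hS'.bddAbove_image hu.continuousOn
    have hab (y) (hy : y ∈ cthickening 1 S) : u y ∈ Icc a b :=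
      ⟨hau y hy, hb (mem_image_of_mem u hy)⟩
    refine ⟨a, b, ha, fun x hx => ⟨hab x (self_subset_cthickening S hx), fun j => ?_⟩⟩
    refine (shrinkingBump _ j).convolution_normed_mem_Icc hu.aestronglyMeasurable fun y hy => ?_
    exact hab y (mem_cthickening_of_dist_le y x 1 _ hx
      ((mem_ball.1 hy).le.trans (shrinkingBump_rOut_le j)))
  have hU0 (j : ℕ) (x : EuclideanSpace ℝ (Fin n)) : 0 < U j x := by
    obtain ⟨a, b, ha, hab⟩ := hUIcc (isCompact_singleton (x := x))
    exact ha.trans_le ((hab x rfl).2 j).1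
  obtain ⟨a, b, ha, hab⟩ := hUIcc hK
  have hsub : Icc a b ⊆ Ioi (0 : ℝ) := fun v hv => ha.trans_le hv.1
  have hψc : ContinuousOn ψ (Ioi 0) := fun v hv => (hψ v hv).continuousAt.continuousWithinAt
  obtain ⟨B, hB⟩ := isCompact_Icc.exists_bound_of_continuousOn (hψc.mono hsub)
  obtain ⟨B', hB'⟩ := isCompact_Icc.exists_bound_of_continuousOn (hψ'.mono hsub)
  obtain ⟨M, hM⟩ := hχ.continuous.bounded_above_of_compact_support hχc
  have hχ' : Continuous (fderiv ℝ χ) := hχ.continuous_fderiv one_ne_zero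
  obtain ⟨M', hM'⟩ := hχ'.bounded_above_of_compact_support (hχc.fderiv ℝ)
  have hχK (x) (hx : x ∉ K) : χ x = 0 := image_eq_zero_of_notMem_tsupport hx
  have hχK' (x) (hx : x ∉ K) : fderiv ℝ χ x = 0 :=
    image_eq_zero_of_notMem_tsupport fun h => hx (tsupport_fderiv_subset ℝ h)
  have hVl : LocallyIntegrable V := hV.locallyIntegrable hpq.symm.lt.le
  have hGl : LocallyIntegrable G := hG.memLpLoc_grad.locallyIntegrable hp.le
  have hGV : IntegrableOn (fun x => (inner ℝ (G x) (V x) : ℝ)) K := by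
    have h1 := MemLp.of_bilin (p := ENNReal.ofReal p) (q := ENNReal.ofReal (p / (p - 1))) (r := 1)
      (fun a b => (inner ℝ a b : ℝ)) 1 (hG.memLpLoc_grad K hK) (hV K hK)
      ((hG.memLpLoc_grad K hK).1.inner (hV K hK).1) (ae_of_all _ fun x => by
        simpa using nnnorm_inner_le_nnnorm (𝕜 := ℝ) (G x) (V x))
    exact memLp_one_iff_integrable.1 h1
  set P : (EuclideanSpace ℝ (Fin n) → ℝ) → EuclideanSpace ℝ (Fin n) → ℝ := fun w x =>
    ψ (w x) * fderiv ℝ χ x (V x) + χ x * ψ' (w x) * inner ℝ (G x) (V x) with hP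
  set bound : EuclideanSpace ℝ (Fin n) → ℝ := K.indicator fun x =>
    B * (M' * ‖V x‖) + M * B' * ‖(inner ℝ (G x) (V x) : ℝ)‖ with hbound
  have hboundi : Integrable bound := by
    rw [hbound, integrable_indicator_iff hK.measurableSet]
    exact (((hVl.integrableOn_isCompact hK).norm.const_mul _).const_mul _).add
      (hGV.norm.const_mul _)
  have hPle {w : EuclideanSpace ℝ (Fin n) → ℝ} (hw : ∀ x ∈ K, w x ∈ Icc a b) (x) :
      ‖P w x‖ ≤ bound x := by
    by_cases hx : x ∈ K
    · have h1 := hB _ (hw x hx)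
      have h2 := hB' _ (hw x hx)
      have h3 : ‖fderiv ℝ χ x (V x)‖ ≤ M' * ‖V x‖ := (le_opNorm _ _).trans (by gcongr; exact hM' x)
      rw [hbound, indicator_of_mem hx]
      refine (norm_add_le _ _).trans ?_
      rw [norm_mul, norm_mul, norm_mul]
      have h4 := hM x
      gcongr
      · exact (norm_nonneg _).trans h1
      · exact (norm_nonneg _).trans h4
    · simp [hP, hbound, hx, hχK x hx, hχK' x hx]
  have hPm {w : EuclideanSpace ℝ (Fin n) → ℝ} (hw : Continuous w) (hw0 : ∀ x, 0 < w x) :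
      AEStronglyMeasurable (P w) := by
    have h1 := (hψc.comp_continuous hw hw0).aestronglyMeasurable (μ := volume)
    have h2 := (hψ'.comp_continuous hw hw0).aestronglyMeasurable (μ := volume)
    exact (h1.mul ((ContinuousLinearMap.id ℝ (EuclideanSpace ℝ (Fin n) →L[ℝ] ℝ)).aestronglyMeasurable_comp₂
      hχ'.aestronglyMeasurable hVl.aestronglyMeasurable)).add
      ((hχ.continuous.aestronglyMeasurable.mul h2).mul
        (hGl.aestronglyMeasurable.inner hVl.aestronglyMeasurable))
  have hPi {w : EuclideanSpace ℝ (Fin n) → ℝ} (hw : Continuous w) (hw0 : ∀ x, 0 < w x)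
      (hwI : ∀ x ∈ K, w x ∈ Icc a b) : Integrable (P w) :=
    hboundi.mono' (hPm hw hw0) (ae_of_all _ (hPle hwI))
  refine ⟨hPi hu hu0 fun x hx => (hab x hx).1, ?_⟩
  -- Replacing `∇U_j` by the fixed `G` gives a main part dominated independently of `j`; the
  -- remainder contains `∇U_j - G` and vanishes by Hölder.
  have hfd (j : ℕ) (x : EuclideanSpace ℝ (Fin n)) :
      fderiv ℝ (fun x => ψ (U j x) * χ x) x (V x) = P (U j) x +
        χ x * ψ' (U j x) * inner ℝ ((gradient (U j) - G) x) (V x) := by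
    have hUd : HasFDerivAt (U j) (fderiv ℝ (U j) x) x :=
      ((hUs j).differentiable one_ne_zero x).hasFDerivAt
    have h1 := ((hψ _ (hU0 j x)).comp_hasFDerivAt x hUd).mul
      (hχ.differentiable one_ne_zero x).hasFDerivAt
    have h2 : fderiv ℝ (U j) x (V x) = inner ℝ (gradient (U j) x) (V x) := by
      rw [gradient, InnerProductSpace.toDual_symm_apply]
    change fderiv ℝ ((ψ ∘ U j) * χ) x (V x) = _
    rw [h1.fderiv]
    simp only [hP, add_apply, smul_apply, smul_eq_mul, Function.comp_apply, Pi.sub_apply,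
      inner_sub_left, h2]
    ring
  have hcd (j : ℕ) : ContDiff ℝ 1 fun x => ψ (U j x) * χ x := by
    refine ContDiff.mul ?_ hχ
    rw [contDiff_one_iff_fderiv]
    have hd (x) := (hψ _ (hU0 j x)).comp_hasFDerivAt x
      ((hUs j).differentiable one_ne_zero x).hasFDerivAt
    refine ⟨fun x => (hd x).differentiableAt, ?_⟩
    rw [show fderiv ℝ (fun x => ψ (U j x)) = fun x => ψ' (U j x) • fderiv ℝ (U j) x from
      funext fun x => (hd x).fderiv]
    exact (hψ'.comp_continuous (hUs j).continuous (hU0 j)).smul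
      ((hUs j).continuous_fderiv one_ne_zero)
  have hj (j : ℕ) : ∫ x, (P (U j) x + χ x * ψ' (U j x) * inner ℝ ((gradient (U j) - G) x) (V x)) ≤
      ∫ x, h x * (ψ (U j x) * χ x) := by
    simp only [← hfd]
    exact integral_fderiv_le_of_contDiff_one hVl hh hineq (hcd j) hχc.mul_left
      fun x => mul_nonneg (hψ0 _ (hU0 j x)) (hχ0 x)
  have hDi (j : ℕ) :
      Integrable fun x => χ x * ψ' (U j x) * inner ℝ ((gradient (U j) - G) x) (V x) := by
    have h1 : Integrable fun x => fderiv ℝ (fun x => ψ (U j x) * χ x) x (V x) := by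
      have hc := (hcd j).continuous_fderiv one_ne_zero
      have hcs : HasCompactSupport (fderiv ℝ fun x => ψ (U j x) * χ x) :=
        (HasCompactSupport.mul_left (f := fun x => ψ (U j x)) hχc).fderiv ℝ
      obtain ⟨N, hN⟩ := hc.bounded_above_of_compact_support hcs
      refine Integrable.mono' (g := (tsupport (fderiv ℝ fun x => ψ (U j x) * χ x)).indicator
        fun x => N * ‖V x‖) ?_ ?_ (ae_of_all _ fun x => ?_)
      · rw [integrable_indicator_iff hcs.isCompact.measurableSet]
        exact (hVl.integrableOn_isCompact hcs.isCompact).norm.const_mul _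
      · exact (ContinuousLinearMap.id ℝ (EuclideanSpace ℝ (Fin n) →L[ℝ] ℝ)).aestronglyMeasurable_comp₂
          hc.aestronglyMeasurable hVl.aestronglyMeasurable
      · by_cases hx : x ∈ tsupport (fderiv ℝ fun x => ψ (U j x) * χ x)
        · rw [indicator_of_mem hx]
          exact (le_opNorm _ _).trans (by gcongr; exact hN x)
        · simp [hx, image_eq_zero_of_notMem_tsupport hx]
    have h2 := h1.sub (hPi (hUs j).continuous (hU0 j) fun x hx => (hab x hx).2 j)
    refine h2.congr (ae_of_all _ fun x => ?_)
    simp only [Pi.sub_apply, hfd]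
    simp
  refine le_of_tendsto_of_tendsto' (b := atTop) ?_ ?_ hj
  · rw [← add_zero (∫ x, _)]
    simp only [fun j => integral_add
      (hPi (hUs j).continuous (hU0 j) fun x hx => (hab x hx).2 j) (hDi j)]
    refine Tendsto.add ?_ ?_
    · refine tendsto_integral_of_dominated_convergence bound
        (fun j => hPm (hUs j).continuous (hU0 j)) hboundi
        (fun j => ae_of_all _ (hPle fun x hx => (hab x hx).2 j)) (ae_of_all _ fun x => ?_)
      have h1 := ((hψc.continuousAt (Ioi_mem_nhds (hu0 x))).tendsto).comp (hUlim x)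
      have h2 := ((hψ'.continuousAt (Ioi_mem_nhds (hu0 x))).tendsto).comp (hUlim x)
      exact (h1.mul_const _).add ((h2.const_mul _).mul_const _)
    · have h1 := tendsto_integral_mul_inner_zero (p := ENNReal.ofReal p) (hV K hK)
        (D := fun j => gradient (U j) - G) (w := fun j x => χ x * ψ' (U j x)) (B := M * B')
        (fun j => ?_) (hG.tendsto_eLpNorm_gradient_convolution_sub hp.le hK) (fun j => ?_)
      · refine h1.congr fun j => setIntegral_eq_integral_of_forall_compl_eq_zero fun x hx => ?_
        rw [hχK x hx, zero_mul, zero_mul]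
      · have hc : Continuous (gradient (U j)) :=
          (LinearIsometryEquiv.continuous _).comp ((hUs j).continuous_fderiv one_ne_zero)
        exact hc.aestronglyMeasurable.sub hGl.aestronglyMeasurable.restrict
      · refine (ae_restrict_mem hK.measurableSet).mono fun x hx => ?_
        rw [abs_mul]
        have h4 := hM x
        exact mul_le_mul h4 (hB' _ ((hab x hx).2 j)) (abs_nonneg _) ((norm_nonneg _).trans h4)
  · refine tendsto_integral_of_dominated_convergence (K.indicator fun x => ‖h x‖ * (B * M)) ?_ ?_
      ?_ (ae_of_all _ fun x => ?_)
    · exact fun j => (hh.mul (hcd j).continuous).aestronglyMeasurable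
    · rw [integrable_indicator_iff hK.measurableSet]
      exact ((hh.norm.mul continuous_const).continuousOn).integrableOn_compact hK
    · refine fun j => ae_of_all _ fun x => ?_
      by_cases hx : x ∈ K
      · rw [indicator_of_mem hx, norm_mul, norm_mul]
        have h1 := hB _ ((hab x hx).2 j)
        have h4 := hM x
        gcongr
        exact (norm_nonneg _).trans h1
      · simp [hx, hχK x hx]
    · have h1 := ((hψc.continuousAt (Ioi_mem_nhds (hu0 x))).tendsto).comp (hUlim x)
      exact (h1.mul_const _).const_mul _

end ChainRule

/-! ### The weight `Φ`, the cutoff, the absorption inequality and the contradiction. -/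

section Nonexistence

open Filter Topology Metric ContinuousLinearMap

theorem exists_primitive_neg_ge_one {k : ℝ → ℝ} (hk : ContinuousOn k (Ioi 0))
    (hk0 : ∀ v, 0 < v → 0 ≤ k v) (hfin : ∫⁻ v in Ioi (1 : ℝ), ENNReal.ofReal (k v) < ⊤) :
    ∃ Φ : ℝ → ℝ, (∀ v, 0 < v → HasDerivAt Φ (-k v) v) ∧ ∀ v, 0 < v → 1 ≤ Φ v := by
  have hsub : Ioi (1 : ℝ) ⊆ Ioi 0 := Ioi_subset_Ioi zero_le_one
  have hki : IntegrableOn k (Ioi 1) := by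
    refine ⟨(hk.mono hsub).aestronglyMeasurable measurableSet_Ioi, ?_⟩
    rw [hasFiniteIntegral_iff_ofReal]
    · exact hfin
    · exact (ae_restrict_mem measurableSet_Ioi).mono fun v hv => hk0 v (hsub hv)
  have hint (v : ℝ) (hv : 0 < v) : IntervalIntegrable k volume 1 v :=
    (hk.mono fun w hw => (lt_min one_pos hv).trans_le hw.1).intervalIntegrable
  -- This is `1 + ∫_v^∞ k`, based at 1 because `k` need not be integrable near 0. The added 1 keeps
  -- negative powers of `Φ` bounded.
  refine ⟨fun v => 1 + (∫ w in Ioi (1 : ℝ), k w) - ∫ w in (1 : ℝ)..v, k w, fun v hv => ?_,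
    fun v hv => ?_⟩
  · refine (intervalIntegral.integral_hasDerivAt_right (hint v hv) ?_
      (hk.continuousAt (Ioi_mem_nhds hv))).const_sub _
    exact ContinuousOn.stronglyMeasurableAtFilter isOpen_Ioi hk v hv
  · have hI : 0 ≤ ∫ w in Ioi (1 : ℝ), k w :=
      setIntegral_nonneg measurableSet_Ioi fun w hw => hk0 w (hsub hw)
    have hle : ∫ w in (1 : ℝ)..v, k w ≤ ∫ w in Ioi (1 : ℝ), k w := by
      rcases le_total 1 v with h | h
      · rw [intervalIntegral.integral_of_le h]
        exact setIntegral_mono_set hki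
          ((ae_restrict_mem measurableSet_Ioi).mono fun w hw => hk0 w (hsub hw))
          Ioc_subset_Ioi_self.eventuallyLE
      · rw [intervalIntegral.integral_symm]
        have := intervalIntegral.integral_nonneg (μ := volume) h
          fun w hw => hk0 w (hv.trans_le hw.1)
        linarith
    linarith

theorem exists_cutoff (n : ℕ) : ∃ M : ℝ, 0 ≤ M ∧ ∀ R : ℝ, 0 < R →
    ∃ η : EuclideanSpace ℝ (Fin n) → ℝ, ContDiff ℝ 1 η ∧ (∀ x, η x ∈ Icc 0 1) ∧
      (∀ x, ‖x‖ ≤ R → η x = 1) ∧ (∀ x, x ∉ closedBall 0 (2 * R) → η x = 0) ∧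
      ∀ x, ‖fderiv ℝ η x‖ ≤ M / R := by
  let b : ContDiffBump (0 : EuclideanSpace ℝ (Fin n)) := ⟨1, 2, one_pos, one_lt_two⟩
  have hb : ContDiff ℝ 1 b := b.contDiff
  obtain ⟨M, hM⟩ := (hb.continuous_fderiv one_ne_zero).bounded_above_of_compact_support
    (b.hasCompactSupport.fderiv ℝ)
  refine ⟨M, (norm_nonneg _).trans (hM 0), fun R hR => ⟨fun x => b (R⁻¹ • x),
    hb.comp (contDiff_id.const_smul _), fun x => ⟨b.nonneg, b.le_one⟩, fun x hx => ?_,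
    fun x hx => ?_, fun x => ?_⟩⟩
  · refine b.one_of_mem_closedBall ?_
    rw [mem_closedBall_zero_iff, norm_smul, norm_inv, Real.norm_of_nonneg hR.le, inv_mul_le_iff₀ hR]
    simpa [b] using hx
  · refine b.zero_of_le_dist ?_
    rw [mem_closedBall_zero_iff, not_le] at hx
    rw [dist_zero_right, norm_smul, norm_inv, Real.norm_of_nonneg hR.le, le_inv_mul_iff₀ hR]
    change R * 2 ≤ _
    linarith
  · have h : fderiv ℝ (fun x => b (R⁻¹ • x)) x = R⁻¹ • fderiv ℝ b (R⁻¹ • x) :=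
      fderiv_comp_smul (f := b) R⁻¹
    rw [h, norm_smul, norm_inv, Real.norm_of_nonneg hR.le, div_eq_inv_mul]
    gcongr
    exact hM _

/-- A weighted Young inequality with the third factor absorbed into a power of `R`. -/
theorem exists_young_const {α θ γ c D : ℝ} (hα : 0 ≤ α) (hθ : 0 ≤ θ) (hγ : 0 < γ)
    (hsum : α + θ + γ = 1) (hc : 0 < c) (hD : 0 ≤ D) :
    ∃ C : ℝ, 0 ≤ C ∧ ∀ X Y R : ℝ, 0 ≤ X → 0 ≤ Y → 0 < R →
      D * (X ^ α * Y ^ θ) / R ≤ c * X + 1 / 2 * Y + C * R ^ (-(1 / γ)) := by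
  -- Normalised so that the weighted geometric mean of `cX`, `Y/2` and `(D'/R)^{1/γ}` is exactly the
  -- left side. The weights, being at most 1, are then dropped.
  set D' := D / (c ^ α * (1 / 2 : ℝ) ^ θ) with hD'
  have hD'0 : 0 ≤ D' := by positivity
  refine ⟨D' ^ (1 / γ), by positivity, fun X Y R hX hY hR => ?_⟩
  have h := Real.geom_mean_le_arith_mean3_weighted hα hθ hγ.le (mul_nonneg hc.le hX)
    (mul_nonneg (by norm_num : (0 : ℝ) ≤ 1 / 2) hY)
    (Real.rpow_nonneg (div_nonneg hD'0 hR.le) (1 / γ)) hsum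
  have hlhs : (c * X) ^ α * (1 / 2 * Y) ^ θ * ((D' / R) ^ (1 / γ)) ^ γ =
      D * (X ^ α * Y ^ θ) / R := by
    have h1 : 0 < c ^ α := by positivity
    have h2 : 0 < (1 / 2 : ℝ) ^ θ := by positivity
    rw [one_div γ, Real.rpow_inv_rpow (by positivity) hγ.ne', Real.mul_rpow hc.le hX,
      Real.mul_rpow (by norm_num) hY, hD']
    field_simp
  have h3 : (D' / R) ^ (1 / γ) = D' ^ (1 / γ) * R ^ (-(1 / γ)) := by
    rw [Real.div_rpow hD'0 hR.le, Real.rpow_neg hR.le, div_eq_mul_inv]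
  rw [hlhs, h3] at h
  refine h.trans ?_
  have hα1 : α ≤ 1 := by linarith
  have hθ1 : θ ≤ 1 := by linarith
  have hγ1 : γ ≤ 1 := by linarith
  have e1 : 0 ≤ c * X := by positivity
  have e3 : 0 ≤ D' ^ (1 / γ) * R ^ (-(1 / γ)) := by positivity
  exact add_le_add (add_le_add (mul_le_of_le_one_left e1 hα1)
    (mul_le_of_le_one_left (by positivity) hθ1)) (mul_le_of_le_one_left e3 hγ1)

/-- The exponents are forced: `α` matches the power of `z`, `θ = α/q` cancels the powers of `g`, and
`β = α/γ` with `γ = 1 - α - θ` matches the powers of `Φ`. The exponent of `R` is then `-1/γ`. -/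
theorem exists_absorption_const {p q c D : ℝ} (hp : 1 < p) (hq : p - 1 < q) (hc : 0 < c)
    (hD : 0 ≤ D) {β : ℝ} (hβ : β = (p - 1) * q / (q - p + 1)) {k : ℕ}
    (hk : p * q / (q - p + 1) ≤ k) :
    ∃ C : ℝ, 0 ≤ C ∧ ∀ z Φ g η R : ℝ, 0 ≤ z → 0 < Φ → 0 < g → η ∈ Icc (0 : ℝ) 1 → 0 < R →
      D * (z ^ (p - 1) * Φ ^ (-β) * η ^ (k - 1)) / R ≤
        c * (z ^ p * (β * Φ ^ (-β - 1) * g ^ (-1 / q)) * η ^ k) +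
          1 / 2 * (g * Φ ^ (-β) * η ^ k) + C * R ^ (-(p * q / (q - p + 1))) := by
  have hp0 : 0 < p := by linarith
  have hp1 : 0 < p - 1 := by linarith
  have hq0 : 0 < q := by linarith
  have hr : 0 < q - p + 1 := by linarith
  have hβ0 : 0 < β := by rw [hβ]; positivity
  set α := (p - 1) / p with hα
  set θ := (p - 1) / (p * q) with hθ
  set γ := (q - p + 1) / (p * q) with hγ
  have hα0 : 0 < α := by positivity
  have hθ0 : 0 < θ := by positivity
  have hγ0 : 0 < γ := by positivity
  have hsum : α + θ + γ = 1 := by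
    rw [hα, hθ, hγ]
    field_simp
    ring
  have hγinv : 1 / γ = p * q / (q - p + 1) := by rw [hγ, one_div_div]
  obtain ⟨C, hC, hY⟩ := exists_young_const hα0.le hθ0.le hγ0 hsum hc
    (div_nonneg hD (Real.rpow_nonneg hβ0.le α))
  refine ⟨C, hC, fun z Φ g η R hz hΦ hg hη hR => ?_⟩
  have hη0 := hη.1
  have h := hY (z ^ p * (β * Φ ^ (-β - 1) * g ^ (-1 / q)) * η ^ k) (g * Φ ^ (-β) * η ^ k) R
    (by positivity) (by positivity) hR
  rw [hγinv] at h
  refine le_trans ?_ h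
  have hXY : (z ^ p * (β * Φ ^ (-β - 1) * g ^ (-1 / q)) * η ^ k) ^ α *
      (g * Φ ^ (-β) * η ^ k) ^ θ = β ^ α * (z ^ (p - 1) * Φ ^ (-β) * (η ^ k) ^ (α + θ)) := by
    rw [Real.mul_rpow (by positivity) (by positivity), Real.mul_rpow (by positivity) (by positivity),
      Real.mul_rpow (by positivity) (by positivity), Real.mul_rpow (by positivity) (by positivity),
      Real.mul_rpow (by positivity) (by positivity), Real.mul_rpow (by positivity) (by positivity),
      ← Real.rpow_mul hz, ← Real.rpow_mul hΦ.le, ← Real.rpow_mul hg.le, ← Real.rpow_mul hΦ.le,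
      Real.rpow_add_of_nonneg (by positivity) hα0.le hθ0.le]
    have e1 : p * α = p - 1 := by rw [hα]; field_simp
    have e2 : -1 / q * α + θ = 0 := by rw [hα, hθ]; field_simp; ring
    have e3 : (-β - 1) * α + -β * θ = -β := by
      rw [hα, hθ, hβ]
      field_simp
      ring
    have e2' : g ^ (-1 / q * α) * g ^ θ = 1 := by rw [← Real.rpow_add hg, e2, Real.rpow_zero]
    have e3' : Φ ^ ((-β - 1) * α) * Φ ^ (-β * θ) = Φ ^ (-β) := by rw [← Real.rpow_add hΦ, e3]
    rw [e1, ← e3']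
    linear_combination z ^ (p - 1) * β ^ α * Φ ^ ((-β - 1) * α) * (η ^ k) ^ α * Φ ^ (-β * θ) *
      (η ^ k) ^ θ * e2'
  -- Since `η ≤ 1`, this needs `k - 1 ≥ k(1 - γ)`, that is `kγ ≥ 1`, which is the lower bound on
  -- `k`. It also excludes `k = 0`, where natural subtraction would truncate.
  have hηk : η ^ (k - 1) ≤ (η ^ k) ^ (α + θ) := by
    have hkγ : 1 ≤ k * γ := by
      rw [← hγinv, one_div, inv_le_iff_one_le_mul₀ hγ0] at hk
      exact hk
    have hk1 : 1 ≤ k := by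
      by_contra hk0
      have : k = 0 := by omega
      subst this
      norm_num at hkγ
    rw [← Real.rpow_natCast_mul hη0, ← Real.rpow_natCast η (k - 1)]
    refine Real.rpow_le_rpow_of_exponent_ge' hη0 hη.2 (by positivity) ?_
    rw [Nat.cast_sub hk1, Nat.cast_one, show α + θ = 1 - γ by linarith]
    linarith
  have hβα : 0 < β ^ α := by positivity
  rw [hXY, ← mul_assoc (D / β ^ α), div_mul_cancel₀ _ hβα.ne']
  gcongr

theorem IsAnisotropy.memLpLoc_anisotropicField {n : ℕ} {H : EuclideanSpace ℝ (Fin n) → ℝ}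
    (hH : IsAnisotropy H) {p : ℝ} (hp : 1 < p)
    {G : EuclideanSpace ℝ (Fin n) → EuclideanSpace ℝ (Fin n)} (hG : MemLpLoc p G) :
    MemLpLoc (p / (p - 1)) fun x => anisotropicField H p (G x) := by
  intro K hK
  have hp1 : 0 < p - 1 := by linarith
  obtain ⟨C, hC, hle⟩ := hH.exists_norm_anisotropicField_le hp
  have h := (hG K hK).norm_rpow_div (ENNReal.ofReal (p - 1))
  rw [ENNReal.toReal_ofReal hp1.le, ← ENNReal.ofReal_div_of_pos hp1] at h
  refine h.of_le_mul (c := C) ?_ (ae_of_all _ fun x => ?_)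
  · exact ((measurable_anisotropicField H p).comp_aemeasurable
      (hG K hK).1.aemeasurable).aestronglyMeasurable
  · rw [Real.norm_of_nonneg (by positivity)]
    exact hle (G x)

/-- The error `R^{-s}` is integrated over a ball of volume comparable to `R^n`, so `n < s` is
exactly what makes it disappear as `R → ∞`. -/
theorem not_isSubsolution_of_hasFiniteTailIntegral {n : ℕ} {p q : ℝ} (hp : 1 < p)
    {H : EuclideanSpace ℝ (Fin n) → ℝ} (hH : IsAnisotropy H) {f : ℝ → ℝ}
    (hf : ContinuousOn f (Ioi 0)) (hf0 : ∀ v, 0 < v → f v < 0) (hq : p - 1 < q)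
    (hnq : (n : ℝ) < p * q / (q - p + 1)) (hfin : HasFiniteTailIntegral f q)
    {u : EuclideanSpace ℝ (Fin n) → ℝ} (hu0 : ∀ x, 0 < u x) : ¬ IsSubsolution H p f u := by
  rintro ⟨hu, G, hG, hineq⟩
  have hp1 : 0 < p - 1 := by linarith
  have hq0 : 0 < q := by linarith
  have hr : 0 < q - p + 1 := by linarith
  set s := p * q / (q - p + 1) with hs
  obtain ⟨β, hβ⟩ : ∃ β, β = (p - 1) * q / (q - p + 1) := ⟨_, rfl⟩
  have hβ0 : 0 < β := by rw [hβ]; positivity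
  set V : EuclideanSpace ℝ (Fin n) → EuclideanSpace ℝ (Fin n) :=
    fun x => anisotropicField H p (G x) with hVdef
  have hV := hH.memLpLoc_anisotropicField hp hG.memLpLoc_grad
  have hfu : Continuous fun x => f (u x) := hf.comp_continuous hu hu0
  have hineq' (φ : EuclideanSpace ℝ (Fin n) → ℝ) (h1 : ContDiff ℝ ∞ φ) (h2 : HasCompactSupport φ)
      (h3 : ∀ x, 0 ≤ φ x) : ∫ x, fderiv ℝ φ x (V x) ≤ ∫ x, f (u x) * φ x := by
    refine le_trans (le_of_eq (integral_congr_ae (ae_of_all _ fun x => ?_))) (hineq φ h1 h2 h3)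
    change _ = inner ℝ (V x) (gradient φ x)
    rw [real_inner_comm, gradient, InnerProductSpace.toDual_symm_apply]
  have hkc : ContinuousOn (fun v => (-f v) ^ (-1 / q)) (Ioi 0) :=
    hf.neg.rpow_const fun v hv => Or.inl (neg_pos.2 (hf0 v hv)).ne'
  obtain ⟨Φ, hΦd, hΦ1⟩ := exists_primitive_neg_ge_one hkc
    (fun v hv => Real.rpow_nonneg (neg_pos.2 (hf0 v hv)).le _) hfin
  have hΦ0 (v : ℝ) (hv : 0 < v) : 0 < Φ v := one_pos.trans_le (hΦ1 v hv)
  have hΦc : ContinuousOn Φ (Ioi 0) := fun v hv => (hΦd v hv).continuousAt.continuousWithinAt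
  set ψ : ℝ → ℝ := fun v => Φ v ^ (-β) with hψ
  set ψ' : ℝ → ℝ := fun v => β * Φ v ^ (-β - 1) * (-f v) ^ (-1 / q) with hψ'
  have hψd (v : ℝ) (hv : 0 < v) : HasDerivAt ψ (ψ' v) v := by
    convert! (hΦd v hv).rpow_const (p := -β) (Or.inl (hΦ0 v hv).ne') using 1
    simp only [hψ']
    ring
  have hψc : ContinuousOn ψ (Ioi 0) := fun v hv => (hψd v hv).continuousAt.continuousWithinAt
  have hψ'c : ContinuousOn ψ' (Ioi 0) :=
    (continuousOn_const.mul (hΦc.rpow_const fun v hv => Or.inl (hΦ0 v hv).ne')).mul hkc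
  have hψ0 (v : ℝ) (hv : 0 < v) : 0 < ψ v := Real.rpow_pos_of_pos (hΦ0 v hv) _
  have hψ'0 (v : ℝ) (hv : 0 < v) : 0 ≤ ψ' v :=
    mul_nonneg (mul_nonneg hβ0.le (Real.rpow_nonneg (hΦ0 v hv).le _))
      (Real.rpow_nonneg (neg_pos.2 (hf0 v hv)).le _)
  obtain ⟨k, hk⟩ := exists_nat_ge s
  obtain ⟨C, hC, hCle⟩ := hH.exists_norm_anisotropicField_le hp
  obtain ⟨c, hc, hcle⟩ := hH.exists_le_inner_anisotropicField hp
  obtain ⟨M, hM, hcut⟩ := exists_cutoff n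
  obtain ⟨C', hC', hyoung⟩ := exists_absorption_const hp hq hc
    (D := k * M * C) (by positivity) hβ hk
  set Y₀ : EuclideanSpace ℝ (Fin n) → ℝ := fun x => -f (u x) * ψ (u x) with hY₀
  have hY₀c : Continuous Y₀ := hfu.neg.mul (hψc.comp_continuous hu hu0)
  have hY₀pos (x) : 0 < Y₀ x := mul_pos (neg_pos.2 (hf0 _ (hu0 x))) (hψ0 _ (hu0 x))
  set κ := (volume : Measure (EuclideanSpace ℝ (Fin n))).real (closedBall 0 1) with hκ
  have hκ0 : 0 < κ := ENNReal.toReal_pos (measure_closedBall_pos volume 0 one_pos).ne'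
    measure_closedBall_lt_top.ne
  obtain ⟨m, hm, hmY⟩ := (isCompact_closedBall (0 : EuclideanSpace ℝ (Fin n)) 1).exists_forall_le'
    hY₀c.continuousOn (a := 0) fun x _ => hY₀pos x
  have key (R : ℝ) (hR : 1 ≤ R) : m * κ ≤ 2 * C' * 2 ^ n * κ * R ^ (-(s - n)) := by
    have hR0 : 0 < R := one_pos.trans_le hR
    obtain ⟨η, hη, hη01, hη1, hηR, hηd⟩ := hcut R hR0
    have hk0 : k ≠ 0 := by
      rintro rfl
      have hs0 : 0 < s := by positivity
      simp only [Nat.cast_zero] at hk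
      linarith
    have hχR (x) (hx : x ∉ closedBall 0 (2 * R)) : η x ^ k = 0 := by rw [hηR x hx, zero_pow hk0]
    have hχc : HasCompactSupport fun x => η x ^ k :=
      HasCompactSupport.intro (isCompact_closedBall 0 (2 * R)) hχR
    have hχ : ContDiff ℝ 1 fun x => η x ^ k := hη.pow k
    obtain ⟨hPi, hP⟩ := hG.integral_comp_mul_le hp hu hu0 hV hfu hineq' hψd hψ'c
      (fun v hv => (hψ0 v hv).le) hχ hχc fun x => pow_nonneg (hη01 x).1 k
    have hYi : Integrable fun x => Y₀ x * η x ^ k :=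
      (hY₀c.mul hχ.continuous).integrable_of_hasCompactSupport hχc.mul_left
    have hBi : Integrable ((closedBall (0 : EuclideanSpace ℝ (Fin n)) (2 * R)).indicator
        fun _ => C' * R ^ (-s)) :=
      (integrable_indicator_iff measurableSet_closedBall).2
        (integrableOn_const measure_closedBall_lt_top.ne)
    -- Pointwise absorption: the coercive term pays for all of `cX`, leaving only `Y/2` and the
    -- error on the ball. Integrated against the upper bound `-∫ Y`, this leaves `∫ Y / 2` bounded
    -- by the error.
    have hlow (x : EuclideanSpace ℝ (Fin n)) : -(1 / 2 * (Y₀ x * η x ^ k)) -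
        (closedBall (0 : EuclideanSpace ℝ (Fin n)) (2 * R)).indicator (fun _ => C' * R ^ (-s)) x ≤
        ψ (u x) * fderiv ℝ (fun x => η x ^ k) x (V x) +
          η x ^ k * ψ' (u x) * inner ℝ (G x) (V x) := by
      have hηx := (hη01 x).1
      have hux := hu0 x
      have hψx := (hψ0 _ hux).le
      by_cases hx : x ∈ closedBall 0 (2 * R)
      · rw [indicator_of_mem hx]
        have hfd : fderiv ℝ (fun x => η x ^ k) x = (k * η x ^ (k - 1)) • fderiv ℝ η x := by
          simpa using ((hη.differentiable one_ne_zero x).hasFDerivAt.pow k).fderiv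
        have h1 : |fderiv ℝ (fun x => η x ^ k) x (V x)| ≤
            k * η x ^ (k - 1) * (M / R * (C * ‖G x‖ ^ (p - 1))) := by
          rw [hfd, smul_apply, smul_eq_mul, abs_mul, abs_of_nonneg (by positivity)]
          gcongr
          exact (le_opNorm _ _).trans
            (mul_le_mul (hηd x) (hCle (G x)) (norm_nonneg _) (by positivity))
        have h2 := hyoung ‖G x‖ (Φ (u x)) (-f (u x)) (η x) R (norm_nonneg _) (hΦ0 _ hux)
          (neg_pos.2 (hf0 _ hux)) (hη01 x) hR0
        have h3 : ψ (u x) * (k * η x ^ (k - 1) * (M / R * (C * ‖G x‖ ^ (p - 1)))) =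
            k * M * C * (‖G x‖ ^ (p - 1) * Φ (u x) ^ (-β) * η x ^ (k - 1)) / R := by
          simp only [hψ]
          ring
        have h4 : η x ^ k * ψ' (u x) * (c * ‖G x‖ ^ p) ≤
            η x ^ k * ψ' (u x) * inner ℝ (G x) (V x) := by
          have := hψ'0 _ hux
          gcongr
          rw [real_inner_comm]
          exact hcle (G x)
        have h5 := mul_le_mul_of_nonneg_left ((neg_le_abs _).trans h1) hψx
        rw [h3] at h5
        simp only [hψ, hψ', hY₀] at h4 h5 ⊢
        linarith
      · have hfd : fderiv ℝ (fun x => η x ^ k) x = 0 := by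
          refine fderiv_of_notMem_tsupport ℝ ?_
          exact fun h => hx (closure_minimal (fun y hy => by
            by_contra hy'
            exact hy (hχR y hy')) isClosed_closedBall h)
        simp [hx, hfd, hχR x hx]
    have h1 := integral_mono ((hYi.const_mul (1 / 2)).neg.sub hBi) hPi hlow
    have h2 : ∫ x, f (u x) * (ψ (u x) * η x ^ k) = -∫ x, Y₀ x * η x ^ k := by
      rw [← integral_neg]
      exact integral_congr_ae (ae_of_all _ fun x => by simp only [hY₀]; ring)
    have h3 := integral_sub (hYi.const_mul (1 / 2)).neg hBi
    simp only [Pi.neg_apply, integral_neg, integral_const_mul] at h3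
    rw [integral_indicator_const _ measurableSet_closedBall, smul_eq_mul,
      Measure.addHaar_real_closedBall' _ _ (by positivity), ← hκ] at h3
    have h4 : m * κ ≤ ∫ x, Y₀ x * η x ^ k := by
      calc m * κ = ∫ x in closedBall (0 : EuclideanSpace ℝ (Fin n)) 1, m := by
            rw [setIntegral_const, smul_eq_mul, mul_comm]
        _ ≤ ∫ x in closedBall (0 : EuclideanSpace ℝ (Fin n)) 1, Y₀ x * η x ^ k := by
            refine setIntegral_mono_on (integrableOn_const measure_closedBall_lt_top.ne)
              hYi.integrableOn measurableSet_closedBall fun x hx => ?_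
            rw [hη1 x ((mem_closedBall_zero_iff.1 hx).trans hR), one_pow, mul_one]
            exact hmY x hx
        _ ≤ _ := setIntegral_le_integral hYi (ae_of_all _ fun x =>
            mul_nonneg (hY₀pos x).le (pow_nonneg (hη01 x).1 k))
    have h5 : R ^ (-(s - n)) = R ^ (-s) * R ^ n := by
      rw [neg_sub, sub_eq_neg_add, Real.rpow_add hR0, Real.rpow_natCast]
    rw [finrank_euclideanSpace, Fintype.card_fin, mul_pow] at h3
    rw [h5]
    simp only [Pi.sub_apply, Pi.neg_apply] at h1
    linarith
  have hlim : Tendsto (fun R : ℝ => 2 * C' * 2 ^ n * κ * R ^ (-(s - n))) atTop (𝓝 0) := by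
    simpa using (tendsto_rpow_neg_atTop (sub_pos.2 hnq)).const_mul (2 * C' * 2 ^ n * κ)
  exact (mul_pos hm hκ0).not_ge (ge_of_tendsto hlim ((eventually_ge_atTop 1).mono key))

/-- After clearing denominators both inequalities read `q(n - p) < n(p - 1)`. -/
theorem natCast_lt_of_lt_lowerStarExponent {n : ℕ} {p q : ℝ} (hpn : p < n) (hq : p - 1 < q)
    (hq' : q < lowerStarExponent n p - 1) : (n : ℝ) < p * q / (q - p + 1) := by
  rw [lowerStarExponent, lt_sub_iff_add_lt, lt_div_iff₀ (by linarith)] at hq'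
  rw [lt_div_iff₀ (by linarith)]
  linarith

/-- `n(q - p + 1) < nq ≤ pq`, with no upper restriction on `q`. -/
theorem natCast_lt_of_le {n : ℕ} {p q : ℝ} (hp : 1 < p) (hn : 0 < n) (hnp : (n : ℝ) ≤ p)
    (hq : p - 1 < q) : (n : ℝ) < p * q / (q - p + 1) := by
  have hn' : (0 : ℝ) < n := by exact_mod_cast hn
  rw [lt_div_iff₀ (by linarith)]
  nlinarith [mul_nonneg (sub_nonneg.2 hnp) (by linarith : 0 ≤ q), mul_pos hn' (sub_pos.2 hp)]

theorem lt_lowerStarExponent {n : ℕ} {p : ℝ} (hp : 1 < p) (hpn : p < n) :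
    p < lowerStarExponent n p := by
  rw [lowerStarExponent, lt_div_iff₀ (by linarith)]
  nlinarith

theorem hasFiniteTailIntegral_neg_rpow {α q : ℝ} (hq : 0 < q) (hqα : q < α) :
    HasFiniteTailIntegral (fun v => -v ^ α) q := by
  have h : IntegrableOn (fun v : ℝ => v ^ (α * (-1 / q))) (Ioi 1) := by
    refine integrableOn_Ioi_rpow_of_lt ?_ one_pos
    have := (one_lt_div hq).2 hqα
    rw [mul_div_assoc', mul_neg_one, neg_div]
    linarith
  refine lt_of_le_of_lt (le_of_eq ?_) h.lintegral_lt_top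
  refine setLIntegral_congr_fun measurableSet_Ioi fun v hv => ?_
  have hv0 : (0 : ℝ) ≤ v := zero_le_one.trans (le_of_lt hv)
  simp only [neg_neg, Real.rpow_mul hv0]

end Nonexistence

theorem theorem1p2 (n : ℕ) (hn : 2 ≤ n) (p : ℝ) (hp : 1 < p)
    (H : EuclideanSpace ℝ (Fin n) → ℝ) (hH : IsAnisotropy H) :
    (∀ f : ℝ → ℝ, ContinuousOn f (Ioi 0) → (∀ v, 0 < v → f v < 0) →
      ((p < n ∧ ∃ q : ℝ, p - 1 < q ∧ q < lowerStarExponent n p - 1 ∧ HasFiniteTailIntegral f q) ∨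
        ((n : ℝ) ≤ p ∧ ∃ q : ℝ, p - 1 < q ∧ HasFiniteTailIntegral f q)) →
      ¬ ∃ u : EuclideanSpace ℝ (Fin n) → ℝ, (∀ x, 0 < u x) ∧ IsSubsolution H p f u) ∧
    (∀ α : ℝ, p - 1 < α →
      ¬ ∃ u : EuclideanSpace ℝ (Fin n) → ℝ,
        (∀ x, 0 < u x) ∧ IsSubsolution H p (fun v => -v ^ α) u) := by
  have main (f : ℝ → ℝ) (hf : ContinuousOn f (Ioi 0)) (hf0 : ∀ v, 0 < v → f v < 0)
      (h : (p < n ∧ ∃ q : ℝ, p - 1 < q ∧ q < lowerStarExponent n p - 1 ∧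
          HasFiniteTailIntegral f q) ∨ ((n : ℝ) ≤ p ∧ ∃ q : ℝ, p - 1 < q ∧
          HasFiniteTailIntegral f q)) :
      ¬ ∃ u : EuclideanSpace ℝ (Fin n) → ℝ, (∀ x, 0 < u x) ∧ IsSubsolution H p f u := by
    rintro ⟨u, hu0, hu⟩
    rcases h with ⟨hpn, q, hq, hq', hfin⟩ | ⟨hnp, q, hq, hfin⟩
    · exact not_isSubsolution_of_hasFiniteTailIntegral hp hH hf hf0 hq
        (natCast_lt_of_lt_lowerStarExponent hpn hq hq') hfin hu0 hu
    · exact not_isSubsolution_of_hasFiniteTailIntegral hp hH hf hf0 hq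
        (natCast_lt_of_le hp (by omega) hnp hq) hfin hu0 hu
  refine ⟨main, fun α hα => main _ ?_ ?_ ?_⟩
  · exact (continuousOn_id.rpow_const fun v hv => Or.inl (ne_of_gt hv)).neg
  · exact fun v hv => neg_neg_of_pos (Real.rpow_pos_of_pos hv α)
  · rcases lt_or_ge p (n : ℝ) with hpn | hnp
    -- Any `q` above `p - 1` and below both `α` and `p_* - 1` works: `q < α` makes `v^{-α/q}`
    -- integrable at infinity, and `p < p_*` leaves room.
    · obtain ⟨q, hq, hq'⟩ := exists_between
        (lt_min hα (sub_lt_sub_right (lt_lowerStarExponent hp hpn) 1))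
      rw [lt_min_iff] at hq'
      exact Or.inl ⟨hpn, q, hq, hq'.2, hasFiniteTailIntegral_neg_rpow (by linarith) hq'.1⟩
    · obtain ⟨q, hq, hq'⟩ := exists_between hα
      exact Or.inr ⟨hnp, q, hq, hasFiniteTailIntegral_neg_rpow (by linarith) hq'⟩
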